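/- Let $D\subset\mathbb R^d$ be compact and let $Y(s)$, $s\in D$, be a real-valued second-order process with mean zero whose covariance function $K(s,x)=\mathrm{Cov}(Y(s),Y(x))$ is continuous on $D\times D$ and satisfies $K(x,x)>0$ for all $x\in D$. Let $\lambda_1\ge\lambda_2\ge\dots\ge 0$ be the Karhunen–Loève (Mercer) eigenvalues of $K$ on $D$, i.e. the positive eigenvalues of the operator $f\mapsto\int_D K(\cdot,x)f(x)\,dx$ on $L^2(D)$, repeated according to multiplicity and followed by zeros if there are only finitely many of them. For $\delta\ge 0$ put $$c(\delta)=\inf\{(K(x_1,x_2)/K(x_2,x_2))^2:\ x_1,x_2\in D,\ \|x_1-x_2\|\le\delta\}.$$ For every $\gamma$ there are positive constants $C_1,C_2$, depending only on $D$, $K$ and $\gamma$, with the following property. For each $n\ge 1$ let $s_1,\dots,s_n\in D$ be distinct points (which may depend on $n$) with Voronoi cells $$D_{n,i}=\{x\in D:\ \|x-s_i\|=\min_{j}\|x-s_j\|\},$$ and let $\delta_{\max}=\delta_{\max}(n)=\max_{i}\operatorname{diam}(D_{n,i})$. Suppose that $\delta_{\max}(n)\to 0$ as $n\to\infty$, that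 all cells have positive volume $|D_{n,i}|$, and that $$\sup_n\frac{\max_{1\le i\le n}|D_{n,i}|}{\min_{1\le i\le n}|D_{n,i}|}\le\gamma .$$ Then $c(\delta_{\max}(n))>0$ for all sufficiently large $n$, and, for every $n\ge1$ with $c(\delta_{\max}(n))>0$ and every $0\le k\le n$, $$\frac1n\sum_{i=k+1}^n\lambda_{n,i}\le C_1\sum_{i=k+1}^n\lambda_i+C_2\left(\frac1{c(\delta_{\max}(n))}-1\right),$$ where $\lambda_{n,1}\ge\dots\ge\lambda_{n,n}$ are the eigenvalues of the kernel matrix $(K(s_i,s_j))_{i,j=1}^n$. (If $c(\delta_{\max}(n))=0$, the right-hand side is read as $+\infty$ and nothing is claimed.) -/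

import Mathlib

open MeasureTheory ProbabilityTheory Filter Topology

noncomputable section

/-- The covariance function `K(s, x) = Cov(Y(s), Y(x))` of a real process `Y` on a space `E`. -/
def covKernel {E Ω : Type*} [MeasurableSpace Ω] (P : Measure Ω) (Y : E → Ω → ℝ) (s x : E) : ℝ :=
  covariance (Y s) (Y x) P

/-- The kernel matrix `V = (K(sᵢ, sⱼ))ᵢⱼ` at the sites `s`. -/
def kernelMatrix {E Ω : Type*} [MeasurableSpace Ω] (P : Measure Ω) (Y : E → Ω → ℝ) {n : ℕ}
    (s : Fin n → E) : Matrix (Fin n) (Fin n) ℝ :=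
  Matrix.of fun i j => covKernel P Y (s i) (s j)

theorem kernelMatrix_isHermitian {E Ω : Type*} [MeasurableSpace Ω] (P : Measure Ω)
    (Y : E → Ω → ℝ) {n : ℕ} (s : Fin n → E) : (kernelMatrix P Y s).IsHermitian := by
  ext i j
  simp [kernelMatrix, covKernel, covariance_comm]

/-- The eigenvalues of the kernel matrix, with multiplicity, in decreasing order. The index starts
at `0`: the value at `i` is the `(i + 1)`-th largest eigenvalue. -/
def kernelMatrixEigenvalue {E Ω : Type*} [MeasurableSpace Ω] (P : Measure Ω) (Y : E → Ω → ℝ)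
    {n : ℕ} (s : Fin n → E) (i : Fin n) : ℝ :=
  (kernelMatrix_isHermitian P Y s).eigenvalues₀ (Fin.cast (Fintype.card_fin n).symm i)

/-- The span in `L²(D)` of all eigenfunctions, with an eigenvalue `ν ≥ μ`, of the integral operator
`f ↦ ∫_D K(·, x) f(x) dx`. -/
def eigenfunctionSpan {E : Type*} [MeasureSpace E] (D : Set E) (K : E → E → ℝ) (μ : ℝ) :
    Submodule ℝ (Lp ℝ 2 (volume.restrict D)) :=
  Submodule.span ℝ {f | ∃ ν : ℝ, μ ≤ ν ∧
    ∀ᵐ s ∂(volume.restrict D), ∫ x in D, K s x * f x = ν * f s}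

/-- The Karhunen–Loève (Mercer) eigenvalues of the kernel `K` on `D`: the positive eigenvalues of
the integral operator with kernel `K` on `L²(D)`, repeated according to multiplicity, in decreasing
order, and followed by zeros if there are only finitely many. The index starts at `0`: the value at
`i` is the `(i + 1)`-th largest eigenvalue, that is, the largest `μ > 0` such that there are at
least `i + 1` linearly independent eigenfunctions with eigenvalues `≥ μ`. -/
def klEigenvalue {E : Type*} [MeasureSpace E] (D : Set E) (K : E → E → ℝ) (i : ℕ) : ℝ :=
  sSup {μ : ℝ | 0 < μ ∧ ((i + 1 : ℕ) : Cardinal) ≤ Module.rank ℝ (eigenfunctionSpan D K μ)}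

/-- The Voronoi cell in `D` of the site `s i`. -/
def voronoiCell {E : Type*} [PseudoMetricSpace E] (D : Set E) {n : ℕ} (s : Fin n → E)
    (i : Fin n) : Set E :=
  {x ∈ D | ∀ j, dist x (s i) ≤ dist x (s j)}

/-- The largest diameter of a Voronoi cell. -/
def maxCellDiam {E : Type*} [PseudoMetricSpace E] (D : Set E) {n : ℕ} (s : Fin n → E) : ℝ :=
  ⨆ i, Metric.diam (voronoiCell D s i)

/-- `c(δ)`, the infimum of `(K(x₁, x₂) / K(x₂, x₂))²` over `x₁, x₂ ∈ D` at distance `≤ δ`. -/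
def localCoeff {E : Type*} [PseudoMetricSpace E] (D : Set E) (K : E → E → ℝ) (δ : ℝ) : ℝ :=
  sInf {r : ℝ | ∃ x₁ ∈ D, ∃ x₂ ∈ D, dist x₁ x₂ ≤ δ ∧ r = (K x₁ x₂ / K x₂ x₂) ^ 2}

end

/-!
The variables `Y s` are regarded as vectors `y s` of the Hilbert space `H = L²(P)`, so that
`K s x = ⟪y s, y x⟫`, and all sums of eigenvalues are compared through squared distances of these
vectors to finite-dimensional subspaces of `H`.

For the kernel matrix, the tail `∑_{i ≥ k}` of the eigenvalues is at most the sum of the squared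
distances of the `y (s i)` to any subspace `L` of dimension at most `k`
(`sum_kernelMatrixEigenvalue_tail_le`). For the integral operator, a suitable such `L` satisfies
`∫_D dist(y x, L)² ≤ ∫_D ‖y x‖² - ∑_{j < k} λ_j`, up to an arbitrarily small error
(`exists_integral_norm_sq_starProjection_le`). To cut the remaining sum off at `n`, where `D` and
the process alone would only give the whole tail, let `S` be the span of the `y (s i)`; it has
dimension at most `n`, so `∫_D ‖y x‖² ≤ ∑_{j < n} λ_j + ∫_D dist(y x, S)²`, with the same
proviso (`integral_norm_sq_le`). All three facts are instances of the Courant–Fischer and Ky Fan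
principles, in the form of `exists_orthonormal_sum_le` and `exists_orthonormal_le_sum`; those need
no enumeration of an eigenbasis, only the dimensions of the spectral subspaces, which is how the
Karhunen–Loève eigenvalues are defined. For the integral operator the required bound on the
orthogonal complement of a spectral subspace comes from the spectral theorem for compact
self-adjoint operators. The operator is `B B†`, where `B g = ⟪g, y ·⟫` maps `H` to `L²(D)`, and
`B` is compact because `y` has compact range.

It remains to compare values at a site and at a point `x` of its cell. The squared correlation of
`y (s i)` and `y x` is at least `c = c(δ_max)`, so each is a multiple of the other up to an error
of squared norm at most `M (1 - c) ≤ M (1 / c - 1)`, where `M` bounds `K x x`. Hence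
`dist(y x, S)² ≤ M (1 / c - 1)`, and `dist(y (s i), L)²` is at most a constant times
`dist(y x, L)²` plus a constant times `1 / c - 1`. Averaging over the cells, which overlap in
null sets only and have volume at least `|D| / (n γ)`, gives the bound
(`average_kernelMatrixEigenvalue_tail_le`).
-/

/-! ### Orthonormal families adapted to flags of subspaces -/

section RankArguments

variable {H : Type*} [NormedAddCommGroup H] [InnerProductSpace ℝ H]

theorem exists_unit_mem_orthogonal_of_finrank_lt_rank (E F : Submodule ℝ H)
    [FiniteDimensional ℝ F] (h : (Module.finrank ℝ F : Cardinal) < Module.rank ℝ E) :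
    ∃ v ∈ E, ‖v‖ = 1 ∧ v ∈ Fᗮ := by
  let f : E →ₗ[ℝ] F := (F.orthogonalProjectionOnto : H →ₗ[ℝ] F) ∘ₗ E.subtype
  have hf : ¬ Function.Injective f := fun hinj => by
    have := LinearMap.rank_le_of_injective f hinj
    rw [← Module.finrank_eq_rank ℝ F] at this
    exact absurd this (not_le.2 h)
  rw [← LinearMap.ker_eq_bot, ← ne_eq, Submodule.ne_bot_iff] at hf
  obtain ⟨v, hv, hv0⟩ := hf
  have hv0' : (v : H) ≠ 0 := by simpa using hv0
  have hvF : (v : H) ∈ Fᗮ := by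
    rw [← Submodule.ker_orthogonalProjectionOnto]; exact hv
  refine ⟨‖(v : H)‖⁻¹ • (v : H), E.smul_mem _ v.2, ?_, Fᗮ.smul_mem _ hvF⟩
  rw [norm_smul, norm_inv, norm_norm, inv_mul_cancel₀ (norm_ne_zero_iff.2 hv0')]

theorem Orthonormal.snoc {m : ℕ} {e : Fin m → H} (he : Orthonormal ℝ e) {v : H} (hv : ‖v‖ = 1)
    (hev : ∀ i, inner ℝ (e i) v = 0) : Orthonormal ℝ (Fin.snoc e v : Fin (m + 1) → H) := by
  constructor
  · intro i
    refine Fin.lastCases ?_ (fun i => ?_) i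
    · simpa using hv
    · simpa using he.1 i
  · intro i j
    refine Fin.lastCases ?_ (fun i => ?_) i <;> refine Fin.lastCases ?_ (fun j => ?_) j
    · simp
    · intro _; simpa [real_inner_comm] using hev j
    · intro _; simpa using hev i
    · intro hij
      have : i ≠ j := fun h => hij (by rw [h])
      simpa using he.2 this

/-- A finite-dimensional space has an orthonormal basis whose `j`-th vector is orthogonal to a
prescribed space of dimension at most `j`: choose the last vector first, then pass to its
orthogonal complement. -/
theorem exists_orthonormal_mem_orthogonal (F : ℕ → Submodule ℝ H)
    (hfin : ∀ j, FiniteDimensional ℝ (F j)) (m : ℕ) (hF : ∀ j < m, Module.finrank ℝ (F j) ≤ j)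
    (S : Submodule ℝ H) [FiniteDimensional ℝ S] (hS : Module.finrank ℝ S = m) :
    ∃ e : Fin m → H, Orthonormal ℝ e ∧ ∀ j, e j ∈ S ∧ e j ∈ (F j)ᗮ := by
  induction m generalizing S with
  | zero => exact ⟨Fin.elim0, ⟨fun i => i.elim0, fun i => i.elim0⟩, fun i => i.elim0⟩
  | succ m ih =>
    have := hfin m
    obtain ⟨v, hvS, hv1, hvF⟩ := exists_unit_mem_orthogonal_of_finrank_lt_rank S (F m) (by
      rw [← Module.finrank_eq_rank ℝ S, hS]
      exact_mod_cast Nat.lt_succ_of_le (hF m (Nat.lt_succ_self m)))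
    have hv0 : v ≠ 0 := by rintro rfl; simp at hv1
    have hle : Submodule.span ℝ {v} ≤ S := by simpa using hvS
    have hdim : Module.finrank ℝ ((Submodule.span ℝ {v})ᗮ ⊓ S : Submodule ℝ H) = m :=
      Submodule.finrank_add_inf_finrank_orthogonal' hle (by
        rw [finrank_span_singleton hv0, hS, add_comm])
    have : FiniteDimensional ℝ ((Submodule.span ℝ {v})ᗮ ⊓ S : Submodule ℝ H) :=
      Submodule.finiteDimensional_of_le inf_le_right
    obtain ⟨e, he, heS⟩ := ih (fun j hj => hF j (hj.trans (Nat.lt_succ_self m)))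
      ((Submodule.span ℝ {v})ᗮ ⊓ S) hdim
    refine ⟨Fin.snoc e v, he.snoc hv1 fun i => ?_, fun j => ?_⟩
    · rw [real_inner_comm]
      exact Submodule.mem_orthogonal_singleton_iff_inner_right.1 (heS i).1.1
    · refine Fin.lastCases ?_ (fun j => ?_) j
      · simpa using ⟨hvS, hvF⟩
      · simpa using ⟨(heS j).1.2, (heS j).2⟩

/-- Half of the Courant–Fischer principle, for an arbitrary function `q` in place of a quadratic
form: if `q` is at most `a j` on the unit vectors orthogonal to some space of dimension at most
`j`, then the trace of `q` over a space of dimension at most `n`, computed in a suitable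
orthonormal basis, is at most `a 0 + ⋯ + a (n - 1)`. -/
theorem exists_orthonormal_sum_le (q : H → ℝ) (a : ℕ → ℝ) (n : ℕ) (ha : ∀ j < n, 0 ≤ a j)
    (hF : ∀ j < n, ∃ F : Submodule ℝ H, FiniteDimensional ℝ F ∧ Module.finrank ℝ F ≤ j ∧
      ∀ g ∈ Fᗮ, q g ≤ a j * ‖g‖ ^ 2)
    (S : Submodule ℝ H) [FiniteDimensional ℝ S] (hS : Module.finrank ℝ S ≤ n) :
    ∃ e : Fin (Module.finrank ℝ S) → H, Orthonormal ℝ e ∧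
      Submodule.span ℝ (Set.range e) = S ∧ ∑ l, q (e l) ≤ ∑ j ∈ Finset.range n, a j := by
  have hF' : ∀ j, ∃ F : Submodule ℝ H, FiniteDimensional ℝ F ∧
      (j < n → Module.finrank ℝ F ≤ j ∧ ∀ g ∈ Fᗮ, q g ≤ a j * ‖g‖ ^ 2) := fun j => by
    by_cases hj : j < n
    · obtain ⟨F, h1, h2⟩ := hF j hj
      exact ⟨F, h1, fun _ => h2⟩
    · exact ⟨⊥, inferInstance, fun h => absurd h hj⟩
  choose F hfin hF' using hF'
  obtain ⟨e, he, heS⟩ := exists_orthonormal_mem_orthogonal F hfin _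
    (fun j hj => (hF' j (hj.trans_le hS)).1) S rfl
  refine ⟨e, he, ?_, ?_⟩
  · refine Submodule.eq_of_le_of_finrank_eq (Submodule.span_le.2 ?_) ?_
    · rintro _ ⟨j, rfl⟩
      exact (heS j).1
    · rw [finrank_span_eq_card he.linearIndependent, Fintype.card_fin]
  · calc ∑ l, q (e l) ≤ ∑ l : Fin (Module.finrank ℝ S), a l := by
          refine Finset.sum_le_sum fun l _ => ?_
          have := (hF' l (l.2.trans_le hS)).2 _ (heS l).2
          simpa [he.1 l] using this
      _ = ∑ j ∈ Finset.range (Module.finrank ℝ S), a j := Fin.sum_univ_eq_sum_range a _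
      _ ≤ ∑ j ∈ Finset.range n, a j :=
          Finset.sum_le_sum_of_subset_of_nonneg (Finset.range_subset_range.2 hS)
            fun j hj _ => ha j (Finset.mem_range.1 hj)

/-- The other half: if `q` is at least `b j` on the unit vectors of a space of dimension at least
`j + 1`, for each `j` with `0 < b j`, then some orthonormal family of at most `k` vectors has
`q`-trace at least `b 0 + ⋯ + b (k - 1)`. -/
theorem exists_orthonormal_le_sum (q : H → ℝ) (b : ℕ → ℝ)
    (hE : ∀ j, b j ≤ 0 ∨ ∃ E : Submodule ℝ H, ((j + 1 : ℕ) : Cardinal) ≤ Module.rank ℝ E ∧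
      ∀ g ∈ E, b j * ‖g‖ ^ 2 ≤ q g) (k : ℕ) :
    ∃ m ≤ k, ∃ e : Fin m → H, Orthonormal ℝ e ∧ ∑ j ∈ Finset.range k, b j ≤ ∑ l, q (e l) := by
  induction k with
  | zero => exact ⟨0, le_rfl, Fin.elim0, ⟨fun i => i.elim0, fun i => i.elim0⟩, by simp⟩
  | succ k ih =>
    obtain ⟨m, hm, e, he, hsum⟩ := ih
    rcases hE k with hk | ⟨E, hrank, hEq⟩
    · refine ⟨m, hm.trans k.le_succ, e, he, ?_⟩
      rw [Finset.sum_range_succ]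
      linarith
    · have hfin : FiniteDimensional ℝ (Submodule.span ℝ (Set.range e)) :=
        FiniteDimensional.span_of_finite ℝ (Set.finite_range e)
      obtain ⟨v, hvE, hv1, hvF⟩ := exists_unit_mem_orthogonal_of_finrank_lt_rank E
        (Submodule.span ℝ (Set.range e)) (by
          rw [finrank_span_eq_card he.linearIndependent, Fintype.card_fin]
          refine lt_of_lt_of_le ?_ hrank
          exact_mod_cast Nat.lt_succ_of_le hm)
      refine ⟨m + 1, Nat.succ_le_succ hm, Fin.snoc e v, he.snoc hv1 fun i => ?_, ?_⟩
      · exact (Submodule.mem_orthogonal _ _).1 hvF _ (Submodule.subset_span ⟨i, rfl⟩)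
      · rw [Finset.sum_range_succ, Fin.sum_univ_castSucc]
        have := hEq v hvE
        simp only [Fin.snoc_castSucc, Fin.snoc_last]
        simp only [hv1] at this
        linarith

theorem norm_sq_starProjection_orthogonal_span {m : ℕ} {e : Fin m → H} (he : Orthonormal ℝ e)
    (S : Submodule ℝ H) [FiniteDimensional ℝ S] (hS : Submodule.span ℝ (Set.range e) = S) (v : H) :
    ‖Sᗮ.starProjection v‖ ^ 2 = ‖v‖ ^ 2 - ∑ l, inner ℝ (e l) v ^ 2 := by
  have hproj : S.starProjection v = ∑ l, inner ℝ (e l) v • e l := by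
    refine Submodule.eq_starProjection_of_mem_of_inner_eq_zero ?_ ?_
    · rw [← hS]
      exact Submodule.sum_mem _ fun l _ =>
        Submodule.smul_mem _ _ (Submodule.subset_span ⟨l, rfl⟩)
    · intro w hw
      rw [← hS] at hw
      induction hw using Submodule.span_induction with
      | mem x hx =>
        obtain ⟨j, rfl⟩ := hx
        have h := he.inner_right_fintype (fun l => inner ℝ (e l) v) j
        rw [inner_sub_left, sub_eq_zero, real_inner_comm, ← h]
        exact real_inner_comm _ _
      | zero => simp
      | add x y _ _ hx hy => rw [inner_add_right, hx, hy, add_zero]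
      | smul c x _ hx => rw [inner_smul_right, hx, mul_zero]
  have h1 : ‖S.starProjection v‖ ^ 2 = ∑ l, inner ℝ (e l) v ^ 2 := by
    rw [hproj, ← real_inner_self_eq_norm_sq, he.inner_sum]
    simp [sq]
  have h2 := Submodule.norm_sq_eq_add_norm_sq_projection v S
  simp only [← Submodule.coe_orthogonalProjectionOnto_apply] at h1 ⊢
  simp only [Submodule.coe_norm] at h1 h2 ⊢
  linarith

end RankArguments

/-! ### Spectral subspaces of compact operators -/

section EigenSpans

variable {X : Type*} [NormedAddCommGroup X] [InnerProductSpace ℝ X]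

/-- The span of all eigenvectors of `T` with an eigenvalue `ν ≥ μ`. -/
def upperEigenspan (T : X →L[ℝ] X) (μ : ℝ) : Submodule ℝ X :=
  Submodule.span ℝ {f | ∃ ν : ℝ, μ ≤ ν ∧ T f = ν • f}

theorem span_eigenvectors_eq_iSup (T : X →L[ℝ] X) (Q : Set ℝ) :
    Submodule.span ℝ {f | ∃ ν ∈ Q, T f = ν • f} =
      ⨆ ν : Q, Module.End.eigenspace (T : Module.End ℝ X) ν := by
  apply le_antisymm
  · refine Submodule.span_le.2 ?_
    rintro f ⟨ν, hν, hf⟩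
    exact Submodule.mem_iSup_of_mem (⟨ν, hν⟩ : Q) (Module.End.mem_eigenspace_iff.2 hf)
  · refine iSup_le fun ν f hf => Submodule.subset_span ?_
    exact ⟨ν, ν.2, Module.End.mem_eigenspace_iff.1 hf⟩

/-- A combination of eigenvectors with eigenvalues in `Q` is an orthogonal sum of eigenvectors, so
that `‖f‖²`, `⟪T f, f⟫` and `‖T f‖²` are weighted sums with weights `1`, `ν`, `ν²`, `ν ∈ Q`. -/
theorem exists_weights_of_mem_span_eigenvectors {T : X →L[ℝ] X}
    (hT : (T : X →ₗ[ℝ] X).IsSymmetric) {Q : Set ℝ} {f : X}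
    (hf : f ∈ Submodule.span ℝ {f | ∃ ν ∈ Q, T f = ν • f}) :
    ∃ (s : Finset Q) (w : Q → ℝ), (∀ ν, 0 ≤ w ν) ∧ ‖f‖ ^ 2 = ∑ ν ∈ s, w ν ∧
      inner ℝ (T f) f = ∑ ν ∈ s, (ν : ℝ) * w ν ∧ ‖T f‖ ^ 2 = ∑ ν ∈ s, (ν : ℝ) ^ 2 * w ν := by
  rw [span_eigenvectors_eq_iSup, Submodule.mem_iSup_iff_exists_finsupp] at hf
  obtain ⟨l, hl, rfl⟩ := hf
  rw [Finsupp.sum]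
  have hfam := hT.orthogonalFamily_eigenspaces.comp (Subtype.coe_injective (p := fun x => x ∈ Q))
  let v : ∀ ν : Q, Module.End.eigenspace (T : Module.End ℝ X) (ν : ℝ) := fun ν => ⟨l ν, hl ν⟩
  have hTl : ∀ ν, T (l ν) = (ν : ℝ) • l ν := fun ν => Module.End.mem_eigenspace_iff.1 (hl ν)
  have hTf : T (∑ ν ∈ l.support, l ν) = ∑ ν ∈ l.support, (ν : ℝ) • l ν := by
    rw [map_sum]; exact Finset.sum_congr rfl fun ν _ => hTl ν
  refine ⟨l.support, fun ν => ‖l ν‖ ^ 2, fun ν => by positivity, ?_, ?_, ?_⟩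
  · exact hfam.norm_sum v l.support
  · rw [hTf]
    refine (hfam.inner_sum (fun ν => (ν : ℝ) • v ν) v l.support).trans ?_
    refine Finset.sum_congr rfl fun ν _ => ?_
    rw [inner_smul_left, real_inner_self_eq_norm_sq]
    rfl
  · rw [hTf]
    refine (hfam.norm_sum (fun ν => (ν : ℝ) • v ν) l.support).trans ?_
    refine Finset.sum_congr rfl fun ν _ => ?_
    rw [norm_smul, mul_pow, Real.norm_eq_abs, sq_abs]
    rfl

theorem le_of_mem_upperEigenspan {T : X →L[ℝ] X} (hT : (T : X →ₗ[ℝ] X).IsSymmetric) {μ : ℝ}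
    (hμ : 0 < μ) {f : X} (hf : f ∈ upperEigenspan T μ) :
    μ * ‖f‖ ^ 2 ≤ inner ℝ (T f) f ∧ μ * inner ℝ (T f) f ≤ ‖T f‖ ^ 2 := by
  obtain ⟨s, w, hw, h1, h2, h3⟩ :=
    exists_weights_of_mem_span_eigenvectors hT (Q := Set.Ici μ) hf
  rw [h1, h2, h3, Finset.mul_sum, Finset.mul_sum]
  constructor <;> refine Finset.sum_le_sum fun ν _ => ?_
  · exact mul_le_mul_of_nonneg_right ν.2 (hw ν)
  · have hν : μ ≤ ν := ν.2
    rw [← mul_assoc, sq]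
    exact mul_le_mul_of_nonneg_right (mul_le_mul_of_nonneg_right hν (hμ.le.trans hν)) (hw ν)

/-- On the orthogonal complement of the eigenvectors with eigenvalue `≥ μ`, the quadratic form of a
compact self-adjoint operator is at most `μ`: by the spectral theorem that complement is the
closed span of the other eigenvectors. -/
theorem inner_le_of_mem_orthogonal_upperEigenspan [CompleteSpace X] {T : X →L[ℝ] X}
    (hT : (T : X →ₗ[ℝ] X).IsSymmetric) (hc : IsCompactOperator T) {μ : ℝ} {f : X}
    (hf : f ∈ (upperEigenspan T μ)ᗮ) : inner ℝ (T f) f ≤ μ * ‖f‖ ^ 2 := by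
  set U : Submodule ℝ X := Submodule.span ℝ {f | ∃ ν ∈ Set.Iio μ, T f = ν • f} with hU
  have hUorth : U ≤ (upperEigenspan T μ)ᗮ := by
    refine Submodule.isOrtho_iff_le.1 (Submodule.isOrtho_span.2 ?_)
    rintro u ⟨ν, hν, hu⟩ v ⟨ξ, hξ, hv⟩
    have h := hT u v
    simp only [ContinuousLinearMap.coe_coe, hu, hv, inner_smul_left, inner_smul_right] at h
    have hne : ν - ξ ≠ 0 := sub_ne_zero.2 (lt_of_lt_of_le hν hξ).ne
    have : (ν - ξ) * inner ℝ u v = 0 := by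
      rw [sub_mul]; simpa [sub_eq_zero] using h
    exact (mul_eq_zero.1 this).resolve_left hne
  have hclosed : U.topologicalClosure ≤ (upperEigenspan T μ)ᗮ :=
    U.topologicalClosure_minimal hUorth (Submodule.isClosed_orthogonal _)
  have : CompleteSpace U.topologicalClosure :=
    U.isClosed_topologicalClosure.completeSpace_coe
  have hfU : f ∈ U.topologicalClosure := by
    obtain ⟨p, hp, r, hr, rfl⟩ := Submodule.exists_add_mem_mem_orthogonal (K := U.topologicalClosure) f
    have hr1 : r ∈ (upperEigenspan T μ)ᗮ := by
      have := Submodule.sub_mem _ hf (hclosed hp)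
      simpa using this
    have hr2 : r ∈ (⨆ ν, Module.End.eigenspace (T : Module.End ℝ X) ν)ᗮ := by
      rw [← Submodule.iInf_orthogonal, Submodule.mem_iInf]
      intro ν
      rw [Submodule.mem_orthogonal]
      intro u hu
      have hu' : T u = ν • u := Module.End.mem_eigenspace_iff.1 hu
      rcases le_or_gt μ ν with h | h
      · exact (Submodule.mem_orthogonal _ _).1 hr1 u (Submodule.subset_span ⟨ν, h, hu'⟩)
      · exact (Submodule.mem_orthogonal _ _).1 hr u
          (U.le_topologicalClosure (Submodule.subset_span ⟨ν, h, hu'⟩))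
    rw [ContinuousLinearMap.orthogonalComplement_iSup_eigenspaces_eq_bot hc hT,
      Submodule.mem_bot] at hr2
    rw [hr2, add_zero]
    exact hp
  have hset : IsClosed {g : X | inner ℝ (T g) g ≤ μ * ‖g‖ ^ 2} :=
    isClosed_le (by fun_prop) (by fun_prop)
  refine closure_minimal (s := (U : Set X)) (fun g hg => ?_) hset hfU
  obtain ⟨s, w, hw, h1, h2, -⟩ := exists_weights_of_mem_span_eigenvectors hT hg
  rw [Set.mem_ofPred_eq, h1, h2, Finset.mul_sum]
  exact Finset.sum_le_sum fun ν _ => mul_le_mul_of_nonneg_right (le_of_lt ν.2) (hw ν)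

theorem upperEigenspan_eq_bot {T : X →L[ℝ] X} {μ : ℝ} (hμ : ‖T‖ < μ) :
    upperEigenspan T μ = ⊥ := by
  rw [upperEigenspan, Submodule.span_eq_bot]
  rintro f ⟨ν, hν, hf⟩
  by_contra hf0
  have h := T.le_opNorm f
  rw [hf, norm_smul, Real.norm_eq_abs] at h
  have := le_of_mul_le_mul_right h (norm_pos_iff.2 hf0)
  linarith [le_abs_self ν]

/-- The `j`-th eigenvalue, counted with multiplicity from `0` in decreasing order, of a positive
compact operator: the largest `μ > 0` for which the eigenvectors with eigenvalue `≥ μ` span a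
space of dimension at least `j + 1`, and `0` if there is none. -/
noncomputable def countedEigenvalue (T : X →L[ℝ] X) (j : ℕ) : ℝ :=
  sSup {μ : ℝ | 0 < μ ∧ ((j + 1 : ℕ) : Cardinal) ≤ Module.rank ℝ (upperEigenspan T μ)}

theorem bddAbove_countedEigenvalue_set (T : X →L[ℝ] X) (j : ℕ) :
    BddAbove {μ : ℝ | 0 < μ ∧ ((j + 1 : ℕ) : Cardinal) ≤ Module.rank ℝ (upperEigenspan T μ)} := by
  refine ⟨‖T‖, fun μ hμ => ?_⟩
  by_contra h
  have h2 := hμ.2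
  rw [upperEigenspan_eq_bot (not_le.1 h), rank_bot] at h2
  simp at h2

theorem countedEigenvalue_nonneg (T : X →L[ℝ] X) (j : ℕ) : 0 ≤ countedEigenvalue T j :=
  Real.sSup_nonneg fun _ h => h.1.le

end EigenSpans

section Factorization

variable {X H : Type*} [NormedAddCommGroup X] [InnerProductSpace ℝ X] [CompleteSpace X]
  [NormedAddCommGroup H] [InnerProductSpace ℝ H] [CompleteSpace H]

open ContinuousLinearMap in
theorem isSymmetric_comp_adjoint (B : H →L[ℝ] X) :
    ((B ∘L adjoint B : X →L[ℝ] X) : X →ₗ[ℝ] X).IsSymmetric := fun u v => by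
  exact (adjoint_inner_right B (adjoint B u) v).symm.trans (adjoint_inner_left B (adjoint B v) u)

open ContinuousLinearMap in
/-- The Courant–Fischer upper bound, transferred from the operator `B B†` on `X` to the quadratic
form `g ↦ ‖B g‖²` of `B† B` on `H`. -/
theorem norm_sq_le_of_mem_orthogonal_map {B : H →L[ℝ] X} {U : Submodule ℝ X} {μ : ℝ} (hμ : 0 ≤ μ)
    (hU : ∀ f ∈ Uᗮ, inner ℝ (B (adjoint B f)) f ≤ μ * ‖f‖ ^ 2) {g : H}
    (hg : g ∈ (U.map (adjoint B : X →ₗ[ℝ] H))ᗮ) : ‖B g‖ ^ 2 ≤ μ * ‖g‖ ^ 2 := by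
  have hBg : B g ∈ Uᗮ := by
    rw [Submodule.mem_orthogonal]
    intro u hu
    rw [← adjoint_inner_left]
    exact (Submodule.mem_orthogonal _ _).1 hg _ (Submodule.mem_map_of_mem hu)
  have h1 : ‖adjoint B (B g)‖ ^ 2 ≤ μ * ‖B g‖ ^ 2 := by
    rw [← real_inner_self_eq_norm_sq, adjoint_inner_right]
    exact hU _ hBg
  have h2 : ‖B g‖ ^ 2 ≤ ‖g‖ * ‖adjoint B (B g)‖ := by
    rw [← real_inner_self_eq_norm_sq, ← adjoint_inner_right]
    exact real_inner_le_norm _ _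
  rcases (norm_nonneg (B g)).eq_or_lt with h0 | h0
  · rw [← h0, zero_pow two_ne_zero]; positivity
  · have h3 : (‖B g‖ ^ 2) ^ 2 ≤ μ * ‖g‖ ^ 2 * ‖B g‖ ^ 2 :=
      calc (‖B g‖ ^ 2) ^ 2 ≤ (‖g‖ * ‖adjoint B (B g)‖) ^ 2 := by gcongr
        _ = ‖g‖ ^ 2 * ‖adjoint B (B g)‖ ^ 2 := by ring
        _ ≤ ‖g‖ ^ 2 * (μ * ‖B g‖ ^ 2) := by gcongr
        _ = μ * ‖g‖ ^ 2 * ‖B g‖ ^ 2 := by ring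
    rw [sq (‖B g‖ ^ 2)] at h3
    exact le_of_mul_le_mul_right h3 (by positivity)

open ContinuousLinearMap in
theorem exists_finrank_le_norm_sq_le (B : H →L[ℝ] X) (hB : IsCompactOperator B) (j : ℕ) {ε : ℝ}
    (hε : 0 < ε) : ∃ F : Submodule ℝ H, FiniteDimensional ℝ F ∧ Module.finrank ℝ F ≤ j ∧
      ∀ g ∈ Fᗮ, ‖B g‖ ^ 2 ≤ (countedEigenvalue (B ∘L adjoint B) j + ε) * ‖g‖ ^ 2 := by
  set T := B ∘L adjoint B with hT
  set μ := countedEigenvalue T j + ε with hμ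
  have hμ0 : 0 < μ := add_pos_of_nonneg_of_pos (countedEigenvalue_nonneg T j) hε
  have hrank : Module.rank ℝ (upperEigenspan T μ) < ((j + 1 : ℕ) : Cardinal) := by
    by_contra h
    have := le_csSup (bddAbove_countedEigenvalue_set T j) ⟨hμ0, not_lt.1 h⟩
    change μ ≤ countedEigenvalue T j at this
    linarith
  have hfin : FiniteDimensional ℝ (upperEigenspan T μ) :=
    Module.rank_lt_aleph0_iff.1 (hrank.trans (Cardinal.natCast_lt_aleph0))
  refine ⟨(upperEigenspan T μ).map (adjoint B : X →ₗ[ℝ] H), inferInstance, ?_, fun g hg => ?_⟩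
  · refine (Submodule.finrank_map_le _ _).trans ?_
    rw [← Module.finrank_eq_rank] at hrank
    exact Nat.lt_succ_iff.1 (by exact_mod_cast hrank)
  · exact norm_sq_le_of_mem_orthogonal_map hμ0.le (fun f hf =>
      inner_le_of_mem_orthogonal_upperEigenspan (isSymmetric_comp_adjoint B)
        (hB.comp_clm _) hf) hg

open ContinuousLinearMap in
theorem exists_le_rank_le_norm_sq (B : H →L[ℝ] X) (j : ℕ) {ε : ℝ} (hε : 0 < ε) :
    countedEigenvalue (B ∘L adjoint B) j - ε ≤ 0 ∨ ∃ E : Submodule ℝ H,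
      ((j + 1 : ℕ) : Cardinal) ≤ Module.rank ℝ E ∧
      ∀ g ∈ E, (countedEigenvalue (B ∘L adjoint B) j - ε) * ‖g‖ ^ 2 ≤ ‖B g‖ ^ 2 := by
  set T := B ∘L adjoint B with hT
  rcases le_or_gt (countedEigenvalue T j - ε) 0 with h0 | h0
  · exact Or.inl h0
  right
  have hne : {μ : ℝ | 0 < μ ∧
      ((j + 1 : ℕ) : Cardinal) ≤ Module.rank ℝ (upperEigenspan T μ)}.Nonempty := by
    by_contra h
    rw [countedEigenvalue, Set.not_nonempty_iff_eq_empty.1 h, Real.sSup_empty] at h0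
    linarith
  obtain ⟨μ, ⟨hμ0, hrank⟩, hμ⟩ :=
    exists_lt_of_lt_csSup hne (sub_lt_self (countedEigenvalue T j) hε)
  have hsymm := isSymmetric_comp_adjoint B
  have hTf : ∀ f, inner ℝ (T f) f = ‖adjoint B f‖ ^ 2 := fun f => by
    rw [← real_inner_self_eq_norm_sq, adjoint_inner_right]; rfl
  refine ⟨(upperEigenspan T μ).map (adjoint B : X →ₗ[ℝ] H), ?_, ?_⟩
  · refine Cardinal.nat_le_lift_iff.1 ((Cardinal.nat_le_lift_iff.2 hrank).trans
      (LinearMap.lift_rank_le_of_injective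
        ((adjoint B : X →ₗ[ℝ] H).submoduleMap (upperEigenspan T μ)) ?_))
    rw [← LinearMap.ker_eq_bot, LinearMap.ker_eq_bot']
    intro f hf
    have h1 : adjoint B (f : X) = 0 := congrArg Subtype.val hf
    have h2 := (le_of_mem_upperEigenspan hsymm hμ0 f.2).1
    rw [hTf, h1] at h2
    have h3 : ‖(f : X)‖ ^ 2 ≤ 0 := by
      simp only [norm_zero] at h2
      nlinarith [sq_nonneg ‖(f : X)‖]
    have h4 : ‖(f : X)‖ = 0 := pow_eq_zero_iff two_ne_zero |>.1 (le_antisymm h3 (sq_nonneg _))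
    exact Subtype.ext (norm_eq_zero.1 h4)
  · rintro _ ⟨f, hf, rfl⟩
    have h2 := (le_of_mem_upperEigenspan hsymm hμ0 hf).2
    rw [hTf] at h2
    exact (mul_le_mul_of_nonneg_right hμ.le (sq_nonneg _)).trans h2

end Factorization

/-! ### The analysis operator of a square integrable family of vectors -/

section AnalysisOperator

variable {α H : Type*} [MeasurableSpace α] {ν : Measure α}
  [NormedAddCommGroup H] [InnerProductSpace ℝ H] {y : α → H}

theorem norm_sq_toLp_two {f : α → ℝ} (hf : MemLp f 2 ν) :
    ‖hf.toLp f‖ ^ 2 = ∫ x, f x ^ 2 ∂ν := by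
  rw [← real_inner_self_eq_norm_sq, L2.inner_def]
  refine integral_congr_ae ?_
  filter_upwards [hf.coeFn_toLp] with x hx
  rw [hx, real_inner_self_eq_norm_sq, Real.norm_eq_abs, sq_abs]

theorem integrable_inner_sq (hy : MemLp y 2 ν) (g : H) :
    Integrable (fun x => inner ℝ g (y x) ^ 2) ν := (hy.const_inner g).integrable_sq

/-- The operator sending `g` to the function `x ↦ ⟪g, y x⟫` in `L²(ν)`, for a square integrable
family of vectors `y`. -/
noncomputable def analysisOperator (hy : MemLp y 2 ν) : H →L[ℝ] Lp ℝ 2 ν :=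
  LinearMap.mkContinuousOfExistsBound
    { toFun := fun g => (hy.const_inner (𝕜 := ℝ) g).toLp _
      map_add' := fun g h => by
        rw [← MemLp.toLp_add]
        congr 1
        ext x
        simp [inner_add_left]
      map_smul' := fun c g => by
        rw [RingHom.id_apply, ← MemLp.toLp_const_smul]
        congr 1
        ext x
        simp [inner_smul_left] }
    ⟨√(∫ x, ‖y x‖ ^ 2 ∂ν), fun g => by
      refine le_of_sq_le_sq ?_ (by positivity)
      have hint : Integrable (fun x => ‖y x‖ ^ 2) ν := hy.integrable_norm_pow (by norm_num)
      rw [mul_pow, Real.sq_sqrt (integral_nonneg fun x => by positivity)]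
      refine (norm_sq_toLp_two (hy.const_inner (𝕜 := ℝ) g)).trans_le ?_
      rw [← integral_mul_const]
      refine integral_mono (integrable_inner_sq hy g) (hint.mul_const _) fun x => ?_
      have := abs_real_inner_le_norm g (y x)
      calc inner ℝ g (y x) ^ 2 = |inner ℝ g (y x)| ^ 2 := (sq_abs _).symm
        _ ≤ (‖g‖ * ‖y x‖) ^ 2 := by gcongr
        _ = ‖y x‖ ^ 2 * ‖g‖ ^ 2 := by ring⟩

theorem coeFn_analysisOperator (hy : MemLp y 2 ν) (g : H) :
    analysisOperator hy g =ᵐ[ν] fun x => inner ℝ g (y x) :=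
  (hy.const_inner (𝕜 := ℝ) g).coeFn_toLp

theorem norm_sq_analysisOperator (hy : MemLp y 2 ν) (g : H) :
    ‖analysisOperator hy g‖ ^ 2 = ∫ x, inner ℝ g (y x) ^ 2 ∂ν :=
  norm_sq_toLp_two (hy.const_inner (𝕜 := ℝ) g)

/-- If the values of `y` are uniformly close to finite-dimensional spaces, the analysis operator is
the norm limit of its compositions with the projections onto these spaces. -/
theorem isCompactOperator_analysisOperator [IsFiniteMeasure ν] (hy : MemLp y 2 ν)
    (hV : ∀ ε > 0, ∃ V : Submodule ℝ H, ∃ _ : FiniteDimensional ℝ V,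
      ∀ᵐ x ∂ν, ‖y x - V.starProjection (y x)‖ ≤ ε) :
    IsCompactOperator (analysisOperator hy) := by
  set B := analysisOperator hy
  have key : ∀ ε : ℝ, 0 < ε → ∃ C : H →L[ℝ] Lp ℝ 2 ν, IsCompactOperator C ∧
      ‖C - B‖ ≤ ε * √(ν.real Set.univ) := fun ε hε => by
    obtain ⟨V, hfin, hV⟩ := hV ε hε
    refine ⟨B ∘L V.starProjection, ?_, ContinuousLinearMap.opNorm_le_bound _ (by positivity)
      fun g => ?_⟩
    · have := FiniteDimensional.proper ℝ V
      have hV : IsCompactOperator (B ∘L V.subtypeL) :=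
        isCompactOperator_of_locallyCompactSpace_rng (B ∘L V.subtypeL)
      exact hV.comp_clm V.orthogonalProjectionOnto
    · refine le_of_sq_le_sq ?_ (by positivity)
      have hsub : (B ∘L V.starProjection - B) g = B (V.starProjection g - g) := by simp
      rw [hsub, norm_sq_analysisOperator, mul_pow, mul_pow, Real.sq_sqrt measureReal_nonneg]
      have : ∫ x, inner ℝ (V.starProjection g - g) (y x) ^ 2 ∂ν ≤ ∫ _, ε ^ 2 * ‖g‖ ^ 2 ∂ν := by
        refine integral_mono_ae (integrable_inner_sq hy _) (integrable_const _) ?_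
        filter_upwards [hV] with x hx
        have h1 : inner ℝ (V.starProjection g - g) (y x)
            = -inner ℝ g (y x - V.starProjection (y x)) := by
          rw [inner_sub_left, inner_sub_right, Submodule.inner_starProjection_left_eq_right]
          ring
        have h2 := abs_real_inner_le_norm g (y x - V.starProjection (y x))
        simp only [h1, neg_sq]
        calc inner ℝ g (y x - V.starProjection (y x)) ^ 2
            = |inner ℝ g (y x - V.starProjection (y x))| ^ 2 := (sq_abs _).symm
          _ ≤ (‖g‖ * ε) ^ 2 := by gcongr; exact h2.trans (by gcongr)
          _ = ε ^ 2 * ‖g‖ ^ 2 := by ring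
      refine this.trans_eq ?_
      rw [integral_const, smul_eq_mul]
      ring
  have hmem : B ∈ closure {C : H →L[ℝ] Lp ℝ 2 ν | IsCompactOperator C} := by
    rw [Metric.mem_closure_iff]
    intro ε hε
    obtain ⟨C, hC, hCB⟩ := key (ε / (√(ν.real Set.univ) + 1)) (by positivity)
    refine ⟨C, hC, ?_⟩
    rw [dist_comm, dist_eq_norm]
    refine hCB.trans_lt ?_
    rw [div_mul_eq_mul_div, div_lt_iff₀ (by positivity)]
    nlinarith
  have hclosed := isClosed_setOfPred_isCompactOperator (σ₁₂ := RingHom.id ℝ) (M₁ := H)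
    (M₂ := Lp ℝ 2 ν)
  exact hclosed.closure_subset hmem

open ContinuousLinearMap in
/-- `B B†`, for the analysis operator `B` of `y`, is the integral operator whose kernel is the
Gram kernel `⟪y s, y x⟫`. -/
theorem coeFn_analysisOperator_comp_adjoint [CompleteSpace H] (hy : MemLp y 2 ν) (f : Lp ℝ 2 ν) :
    (analysisOperator hy ∘L adjoint (analysisOperator hy)) f =ᵐ[ν]
      fun s => ∫ x, inner ℝ (y s) (y x) * f x ∂ν := by
  refine (coeFn_analysisOperator hy _).trans (Eventually.of_forall fun s => ?_)
  refine (adjoint_inner_left (analysisOperator hy) (y s) f).trans ?_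
  rw [L2.inner_def]
  refine integral_congr_ae ?_
  filter_upwards [coeFn_analysisOperator hy (y s)] with x hx
  rw [hx]
  rfl

theorem exists_starProjection_near_of_isCompact {K : Set H} (hK : IsCompact K) {ε : ℝ}
    (hε : 0 < ε) : ∃ V : Submodule ℝ H, ∃ _ : FiniteDimensional ℝ V,
      ∀ v ∈ K, ‖v - V.starProjection v‖ ≤ ε := by
  obtain ⟨t, -, ht, hKt⟩ := hK.finite_cover_balls hε
  have hfin := FiniteDimensional.span_of_finite ℝ ht
  refine ⟨Submodule.span ℝ t, hfin, fun v hv => ?_⟩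
  obtain ⟨w, hw, hvw⟩ := Set.mem_iUnion₂.1 (hKt hv)
  rw [Metric.mem_ball, dist_eq_norm] at hvw
  rw [Submodule.starProjection_minimal]
  exact (ciInf_le ⟨0, by rintro _ ⟨x, rfl⟩; positivity⟩
    (⟨w, Submodule.subset_span hw⟩ : Submodule.span ℝ t)).trans hvw.le

open ContinuousLinearMap in
/-- The counted eigenvalues of the integral operator with a Gram kernel are the Karhunen–Loève
eigenvalues of that kernel. -/
theorem klEigenvalue_eq_countedEigenvalue {E : Type*} [MeasureSpace E] {D : Set E}
    (hD : MeasurableSet D) [CompleteSpace H] {y : E → H} (hy : MemLp y 2 (volume.restrict D))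
    {K : E → E → ℝ} (hK : ∀ s ∈ D, ∀ x ∈ D, K s x = inner ℝ (y s) (y x)) (j : ℕ) :
    klEigenvalue D K j =
      countedEigenvalue (analysisOperator hy ∘L adjoint (analysisOperator hy)) j := by
  have hspan : ∀ μ, eigenfunctionSpan D K μ =
      upperEigenspan (analysisOperator hy ∘L adjoint (analysisOperator hy)) μ := fun μ => by
    unfold eigenfunctionSpan upperEigenspan
    congr 1
    ext f
    refine exists_congr fun ξ => and_congr_right fun _ => ?_
    have h1 := coeFn_analysisOperator_comp_adjoint hy f
    have h2 : (fun s => ∫ x, inner ℝ (y s) (y x) * f x ∂(volume.restrict D))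
        =ᵐ[volume.restrict D] fun s => ∫ x in D, K s x * f x := by
      filter_upwards [ae_restrict_mem hD] with s hs
      refine integral_congr_ae ?_
      filter_upwards [ae_restrict_mem hD] with x hx
      simp only [hK s hs x hx]
    rw [Lp.ext_iff]
    constructor
    · intro h
      refine (h1.trans h2).trans (EventuallyEq.trans h ?_)
      filter_upwards [Lp.coeFn_smul ξ f] with x hx
      simp [hx]
    · intro h
      refine ((h1.trans h2).symm.trans h).trans ?_
      filter_upwards [Lp.coeFn_smul ξ f] with x hx
      simp [hx]
  unfold klEigenvalue countedEigenvalue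
  rw [funext hspan]

end AnalysisOperator

/-! ### Eigenvalues of Gram matrices -/

section GramMatrix

variable {H : Type*} [NormedAddCommGroup H] [InnerProductSpace ℝ H] {n : ℕ}

/-- The operator `g ↦ (⟪y i, g⟫)ᵢ` of a finite family of vectors. -/
noncomputable def finiteAnalysisOperator (y : Fin n → H) : H →L[ℝ] EuclideanSpace ℝ (Fin n) :=
  (EuclideanSpace.equiv (Fin n) ℝ).symm.toContinuousLinearMap ∘L
    ContinuousLinearMap.pi fun i => innerSL ℝ (y i)

theorem finiteAnalysisOperator_apply (y : Fin n → H) (g : H) (i : Fin n) :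
    finiteAnalysisOperator y g i = inner ℝ (y i) g := rfl

theorem norm_sq_finiteAnalysisOperator (y : Fin n → H) (g : H) :
    ‖finiteAnalysisOperator y g‖ ^ 2 = ∑ i, inner ℝ g (y i) ^ 2 := by
  rw [EuclideanSpace.real_norm_sq_eq]
  simp only [finiteAnalysisOperator_apply, real_inner_comm]

open ContinuousLinearMap in
theorem adjoint_finiteAnalysisOperator_apply [CompleteSpace H] (y : Fin n → H)
    (c : EuclideanSpace ℝ (Fin n)) : adjoint (finiteAnalysisOperator y) c = ∑ l, c l • y l := by
  refine ext_inner_right ℝ fun g => ?_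
  rw [adjoint_inner_left, sum_inner, PiLp.inner_apply]
  refine Finset.sum_congr rfl fun l _ => ?_
  rw [inner_smul_left, finiteAnalysisOperator_apply]
  simp [mul_comm]

theorem inner_le_of_eigenbasis {X : Type*} [NormedAddCommGroup X] [InnerProductSpace ℝ X]
    {T : X →L[ℝ] X} (hT : (T : X →ₗ[ℝ] X).IsSymmetric) (b : OrthonormalBasis (Fin n) ℝ X)
    {lam : Fin n → ℝ} (hanti : Antitone lam) (hb : ∀ j, T (b j) = lam j • b j) (j : Fin n) {f : X}
    (hf : f ∈ (Submodule.span ℝ (b '' {i | i < j}))ᗮ) : inner ℝ (T f) f ≤ lam j * ‖f‖ ^ 2 := by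
  have hsum : inner ℝ (T f) f = ∑ i, lam i * inner ℝ (b i) f ^ 2 := by
    rw [← b.sum_inner_mul_inner]
    refine Finset.sum_congr rfl fun i _ => ?_
    have h : inner ℝ (T f) (b i) = inner ℝ f (T (b i)) := hT f (b i)
    rw [h, hb, inner_smul_right, real_inner_comm]
    ring
  rw [hsum, ← b.sum_sq_norm_inner_right, Finset.mul_sum]
  refine Finset.sum_le_sum fun i _ => ?_
  rw [Real.norm_eq_abs, sq_abs]
  rcases lt_or_ge i j with h | h
  · have : inner ℝ (b i) f = 0 :=
      (Submodule.mem_orthogonal _ _).1 hf _ (Submodule.subset_span ⟨i, h, rfl⟩)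
    simp [this]
  · exact mul_le_mul_of_nonneg_right (hanti h) (sq_nonneg _)

open ContinuousLinearMap in
/-- The sum of the eigenvalues of a Gram matrix from the index `k` on is at most the sum of the
squared distances of the vectors to any subspace of dimension at most `k`. -/
theorem sum_eigenvalues_tail_le [CompleteSpace H] (y : Fin n → H) {lam : Fin n → ℝ}
    (hanti : Antitone lam) (b : OrthonormalBasis (Fin n) ℝ (EuclideanSpace ℝ (Fin n)))
    (hb : ∀ j i, ∑ l, inner ℝ (y i) (y l) * b j l = lam j * b j i)
    (htr : ∑ i, ‖y i‖ ^ 2 = ∑ j, lam j) {k : ℕ} (hk : k ≤ n) (S : Submodule ℝ H)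
    [FiniteDimensional ℝ S] (hS : Module.finrank ℝ S ≤ k) :
    ∑ i ∈ Finset.univ.filter (fun i : Fin n => k ≤ (i : ℕ)), lam i ≤
      ∑ i, ‖Sᗮ.starProjection (y i)‖ ^ 2 := by
  obtain ⟨C, hC⟩ : ∃ C, C = finiteAnalysisOperator y := ⟨_, rfl⟩
  have hbT : ∀ j, (C ∘L adjoint C) (b j) = lam j • b j := fun j => by
    ext i
    rw [ContinuousLinearMap.comp_apply, hC, finiteAnalysisOperator_apply,
      adjoint_finiteAnalysisOperator_apply, inner_sum, PiLp.smul_apply, smul_eq_mul, ← hb]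
    refine Finset.sum_congr rfl fun l _ => ?_
    rw [inner_smul_right, mul_comm]
  have hlam : ∀ j, 0 ≤ lam j := fun j => by
    have h : inner ℝ ((C ∘L adjoint C) (b j)) (b j) = ‖adjoint C (b j)‖ ^ 2 := by
      rw [← real_inner_self_eq_norm_sq, adjoint_inner_right]; rfl
    rw [hbT, inner_smul_left, real_inner_self_eq_norm_sq, b.norm_eq_one] at h
    have h' : lam j = ‖adjoint C (b j)‖ ^ 2 := by simpa using h
    exact h'.symm ▸ sq_nonneg _
  let a : ℕ → ℝ := fun j => if h : j < n then lam ⟨j, h⟩ else 0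
  have ha : ∀ i : Fin n, a i = lam i := fun i => by simp [a]
  have hF : ∀ j < k, ∃ F : Submodule ℝ H, FiniteDimensional ℝ F ∧ Module.finrank ℝ F ≤ j ∧
      ∀ g ∈ Fᗮ, ‖C g‖ ^ 2 ≤ a j * ‖g‖ ^ 2 := fun j hj => by
    obtain ⟨i, rfl⟩ : ∃ i : Fin n, (i : ℕ) = j := ⟨⟨j, hj.trans_le hk⟩, rfl⟩
    have hfin : FiniteDimensional ℝ (Submodule.span ℝ (b '' {l | l < i})) :=
      FiniteDimensional.span_of_finite ℝ (Set.toFinite _)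
    refine ⟨(Submodule.span ℝ (b '' {l | l < i})).map
      (adjoint C : EuclideanSpace ℝ (Fin n) →ₗ[ℝ] H), inferInstance, ?_, fun g hg => ?_⟩
    · refine (Submodule.finrank_map_le _ _).trans ?_
      have h1 : b '' {l | l < i} = ((Finset.Iio i).image b : Finset _) := by
        ext; simp
      rw [h1]
      refine (finrank_span_finset_le_card _).trans (Finset.card_image_le.trans ?_)
      simp
    · rw [ha]
      have hU : ∀ f ∈ (Submodule.span ℝ (b '' {l | l < i}))ᗮ,
          inner ℝ (C (adjoint C f)) f ≤ lam i * ‖f‖ ^ 2 := fun f hf =>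
        inner_le_of_eigenbasis (T := C ∘L adjoint C) (isSymmetric_comp_adjoint C) b hanti hbT i hf
      exact norm_sq_le_of_mem_orthogonal_map (hlam i) hU hg
  have ha0 : ∀ j < k, 0 ≤ a j := fun j hj => by
    obtain ⟨i, rfl⟩ : ∃ i : Fin n, (i : ℕ) = j := ⟨⟨j, hj.trans_le hk⟩, rfl⟩
    exact (ha i).symm ▸ hlam i
  obtain ⟨e, he, heS, hsum⟩ := exists_orthonormal_sum_le (fun g => ‖C g‖ ^ 2) a k ha0 hF S hS
  have hres : ∑ i, ‖Sᗮ.starProjection (y i)‖ ^ 2 = ∑ j, lam j - ∑ l, ‖C (e l)‖ ^ 2 := by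
    simp only [norm_sq_starProjection_orthogonal_span he S heS, hC,
      norm_sq_finiteAnalysisOperator]
    rw [Finset.sum_sub_distrib, htr, Finset.sum_comm]
  have hhead : ∑ i ∈ Finset.univ.filter (fun i : Fin n => ¬ k ≤ (i : ℕ)), lam i =
      ∑ j ∈ Finset.range k, a j := by
    refine Finset.sum_bij (fun i _ => (i : ℕ)) ?_ ?_ ?_ ?_
    · intro i hi
      simpa using hi
    · intro i _ j _ h
      exact Fin.ext h
    · intro j hj
      have hj' := Finset.mem_range.1 hj
      exact ⟨⟨j, hj'.trans_le hk⟩, by simpa using hj', rfl⟩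
    · intro i _
      exact (ha i).symm
  have hsplit := Finset.sum_filter_add_sum_filter_not Finset.univ
    (fun i : Fin n => k ≤ (i : ℕ)) lam
  rw [hres]
  linarith

theorem sum_kernelMatrixEigenvalue_tail_le [CompleteSpace H] {E Ω : Type*} [MeasurableSpace Ω]
    (P : Measure Ω) (Y : E → Ω → ℝ) (s : Fin n → E) (y : Fin n → H)
    (hy : ∀ i j, covKernel P Y (s i) (s j) = inner ℝ (y i) (y j)) {k : ℕ} (hk : k ≤ n)
    (S : Submodule ℝ H) [FiniteDimensional ℝ S] (hS : Module.finrank ℝ S ≤ k) :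
    ∑ i ∈ Finset.univ.filter (fun i : Fin n => k ≤ (i : ℕ)), kernelMatrixEigenvalue P Y s i ≤
      ∑ i, ‖Sᗮ.starProjection (y i)‖ ^ 2 := by
  set hA := kernelMatrix_isHermitian P Y s
  let σ : Fin n ≃ Fin n := (finCongr (Fintype.card_fin n).symm).trans
    (Fintype.equivOfCardEq (Fintype.card_fin _))
  have hσ : ∀ j, hA.eigenvalues (σ j) = kernelMatrixEigenvalue P Y s j := fun j => by
    simp [Matrix.IsHermitian.eigenvalues, σ, kernelMatrixEigenvalue]
  refine sum_eigenvalues_tail_le y ?_ (hA.eigenvectorBasis.reindex σ.symm) ?_ ?_ hk S hS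
  · intro i j hij
    exact hA.eigenvalues₀_antitone hij
  · intro j i
    have h := congrFun (hA.mulVec_eigenvectorBasis (σ j)) i
    rw [hσ] at h
    simpa [Matrix.mulVec, dotProduct, kernelMatrix, hy] using h
  · calc ∑ i, ‖y i‖ ^ 2 = (kernelMatrix P Y s).trace := by
          simp [Matrix.trace, kernelMatrix, hy]
      _ = ∑ i, hA.eigenvalues i := by simpa using hA.trace_eq_sum_eigenvalues
      _ = ∑ j, hA.eigenvalues (σ j) := (σ.sum_comp _).symm
      _ = ∑ j, kernelMatrixEigenvalue P Y s j := Finset.sum_congr rfl fun j _ => hσ j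

end GramMatrix

/-! ### Correlations, Voronoi cells and the coefficient `c(δ)` -/

section PointwiseComparison

variable {H : Type*} [NormedAddCommGroup H] [InnerProductSpace ℝ H]

theorem norm_sq_sub_smul_le {u v : H} (hv : v ≠ 0) {c : ℝ}
    (hc : c * (‖u‖ ^ 2 * ‖v‖ ^ 2) ≤ inner ℝ u v ^ 2) :
    ‖u - (inner ℝ u v / ‖v‖ ^ 2) • v‖ ^ 2 ≤ ‖u‖ ^ 2 * (1 - c) := by
  have hv' : 0 < ‖v‖ ^ 2 := by positivity
  have h : ‖u - (inner ℝ u v / ‖v‖ ^ 2) • v‖ ^ 2 = ‖u‖ ^ 2 - inner ℝ u v ^ 2 / ‖v‖ ^ 2 := by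
    rw [norm_sub_sq_real, inner_smul_right, norm_smul, mul_pow, Real.norm_eq_abs, sq_abs]
    field_simp
    ring
  rw [h]
  have : c * ‖u‖ ^ 2 ≤ inner ℝ u v ^ 2 / ‖v‖ ^ 2 := by
    rw [le_div_iff₀ hv']; linarith
  linarith

theorem one_sub_le_inv_sub_one {c : ℝ} (hc : 0 < c) : 1 - c ≤ 1 / c - 1 := by
  have h : 1 / c - 1 - (1 - c) = (1 - c) ^ 2 / c := by field_simp
  have : 0 ≤ (1 - c) ^ 2 / c := by positivity
  linarith

/-- If both one-sided coefficients `⟪u, v⟫ / ‖v‖²` and `⟪u, v⟫ / ‖u‖²` have square at least `c`,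
so has the correlation coefficient. -/
theorem mul_le_inner_sq {u v : H} (hu : u ≠ 0) (hv : v ≠ 0) {c : ℝ} (hc0 : 0 ≤ c)
    (h1 : c ≤ (inner ℝ u v / ‖v‖ ^ 2) ^ 2) (h2 : c ≤ (inner ℝ u v / ‖u‖ ^ 2) ^ 2) :
    c * (‖u‖ ^ 2 * ‖v‖ ^ 2) ≤ inner ℝ u v ^ 2 := by
  have hu' : 0 < ‖u‖ ^ 2 := by positivity
  have hv' : 0 < ‖v‖ ^ 2 := by positivity
  rw [div_pow, le_div_iff₀ (by positivity)] at h1 h2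
  rcases le_total (‖u‖ ^ 2) (‖v‖ ^ 2) with h | h
  · refine le_trans ?_ h1
    rw [sq (‖v‖ ^ 2)]
    gcongr
  · refine le_trans ?_ h2
    rw [sq (‖u‖ ^ 2)]
    gcongr

variable {m M c : ℝ}

theorem norm_sq_starProjection_orthogonal_le_of_mem (S : Submodule ℝ H)
    [S.HasOrthogonalProjection] {u v : H} (hvS : v ∈ S) (hu : ‖u‖ ^ 2 ≤ M) (hv : v ≠ 0)
    (hc0 : 0 < c) (hc1 : c ≤ 1) (hc : c * (‖u‖ ^ 2 * ‖v‖ ^ 2) ≤ inner ℝ u v ^ 2) :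
    ‖Sᗮ.starProjection u‖ ^ 2 ≤ M * (1 / c - 1) := by
  have h0 : Sᗮ.starProjection v = 0 :=
    Submodule.starProjection_orthogonal_apply_eq_zero hvS
  have h1 : Sᗮ.starProjection u =
      Sᗮ.starProjection (u - (inner ℝ u v / ‖v‖ ^ 2) • v) := by
    rw [map_sub, map_smul, h0, smul_zero, sub_zero]
  calc ‖Sᗮ.starProjection u‖ ^ 2 ≤ ‖u - (inner ℝ u v / ‖v‖ ^ 2) • v‖ ^ 2 := by
        rw [h1]
        gcongr
        exact Submodule.norm_starProjection_apply_le _ _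
    _ ≤ ‖u‖ ^ 2 * (1 - c) := norm_sq_sub_smul_le hv hc
    _ ≤ M * (1 / c - 1) :=
        mul_le_mul hu (one_sub_le_inv_sub_one hc0) (by linarith) ((sq_nonneg _).trans hu)

theorem norm_sq_starProjection_le_two_mul (U : Submodule ℝ H) [U.HasOrthogonalProjection]
    {u v : H} (hm : 0 < m) (hu : ‖u‖ ^ 2 ≤ M) (hv : m ≤ ‖v‖ ^ 2) (hc0 : 0 < c) (hc1 : c ≤ 1)
    (hc : c * (‖u‖ ^ 2 * ‖v‖ ^ 2) ≤ inner ℝ u v ^ 2) :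
    ‖U.starProjection u‖ ^ 2 ≤
      2 * (M / m) * ‖U.starProjection v‖ ^ 2 + 2 * M * (1 / c - 1) := by
  have hv' : 0 < ‖v‖ ^ 2 := hm.trans_le hv
  have hv0 : v ≠ 0 := by rintro rfl; simp at hv'
  have hM : 0 ≤ M := (sq_nonneg _).trans hu
  set a := inner ℝ u v / ‖v‖ ^ 2 with ha
  have ha2 : a ^ 2 ≤ M / m := by
    have h1 : inner ℝ u v ^ 2 ≤ ‖u‖ ^ 2 * ‖v‖ ^ 2 := by
      rw [← mul_pow, ← sq_abs (inner ℝ u v)]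
      gcongr
      exact abs_real_inner_le_norm u v
    calc a ^ 2 = inner ℝ u v ^ 2 / (‖v‖ ^ 2 * ‖v‖ ^ 2) := by rw [ha, div_pow, sq (‖v‖ ^ 2)]
      _ ≤ ‖u‖ ^ 2 * ‖v‖ ^ 2 / (‖v‖ ^ 2 * ‖v‖ ^ 2) := by gcongr
      _ = ‖u‖ ^ 2 / ‖v‖ ^ 2 := by field_simp
      _ ≤ M / m := by gcongr
  have hres : ‖U.starProjection (u - a • v)‖ ^ 2 ≤ M * (1 / c - 1) :=
    calc ‖U.starProjection (u - a • v)‖ ^ 2 ≤ ‖u - a • v‖ ^ 2 := by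
          gcongr
          exact Submodule.norm_starProjection_apply_le _ _
      _ ≤ ‖u‖ ^ 2 * (1 - c) := norm_sq_sub_smul_le hv0 hc
      _ ≤ M * (1 / c - 1) := mul_le_mul hu (one_sub_le_inv_sub_one hc0) (by linarith) hM
  have hsplit : U.starProjection u = a • U.starProjection v + U.starProjection (u - a • v) := by
    rw [map_sub, map_smul, add_sub_cancel]
  have hpar : ‖U.starProjection u‖ ^ 2 ≤
      2 * (a ^ 2 * ‖U.starProjection v‖ ^ 2) + 2 * ‖U.starProjection (u - a • v)‖ ^ 2 := by
    have h1 := norm_add_le (a • U.starProjection v) (U.starProjection (u - a • v))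
    rw [← hsplit, norm_smul, Real.norm_eq_abs] at h1
    have h2 : (|a| * ‖U.starProjection v‖) ^ 2 = a ^ 2 * ‖U.starProjection v‖ ^ 2 := by
      rw [mul_pow, sq_abs]
    rw [← h2, ← mul_add]
    exact (pow_le_pow_left₀ (norm_nonneg _) h1 2).trans add_sq_le
  have := mul_le_mul_of_nonneg_right ha2 (sq_nonneg ‖U.starProjection v‖)
  linarith

end PointwiseComparison

section VoronoiCells

variable {d n : ℕ} {D : Set (EuclideanSpace ℝ (Fin d))} {s : Fin n → EuclideanSpace ℝ (Fin d)}

theorem voronoiCell_subset (i : Fin n) : voronoiCell D s i ⊆ D := fun _ hx => hx.1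

theorem measurableSet_voronoiCell (hD : MeasurableSet D) (i : Fin n) :
    MeasurableSet (voronoiCell D s i) := by
  have h : voronoiCell D s i = D ∩ ⋂ j, {x | dist x (s i) ≤ dist x (s j)} := by
    ext x
    simp [voronoiCell]
  rw [h]
  exact hD.inter (MeasurableSet.iInter fun j =>
    (isClosed_le (by fun_prop) (by fun_prop)).measurableSet)

theorem iUnion_voronoiCell (hn : 0 < n) : ⋃ i, voronoiCell D s i = D := by
  refine subset_antisymm (Set.iUnion_subset voronoiCell_subset) fun x hx => ?_
  have : Nonempty (Fin n) := ⟨⟨0, hn⟩⟩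
  obtain ⟨i, hi⟩ := Finite.exists_min fun j => dist x (s j)
  exact Set.mem_iUnion.2 ⟨i, hx, hi⟩

/-- Two cells meet inside the perpendicular bisector of their sites, a null set. -/
theorem aedisjoint_voronoiCell (hs : Function.Injective s) :
    Pairwise (Function.onFun (AEDisjoint volume) (voronoiCell D s)) := fun i j hij => by
  refine measure_mono_null (t := (AffineSubspace.perpBisector (s i) (s j) : Set _)) ?_ ?_
  · rintro x ⟨hi, hj⟩
    exact AffineSubspace.mem_perpBisector_iff_dist_eq.2 (le_antisymm (hi.2 j) (hj.2 i))
  · refine Measure.addHaar_affineSubspace volume _ fun h => hij (hs ?_)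
    exact AffineSubspace.perpBisector_eq_top.1 h

theorem setIntegral_eq_sum_voronoiCell (hD : MeasurableSet D) (hn : 0 < n)
    (hs : Function.Injective s) {f : EuclideanSpace ℝ (Fin d) → ℝ} (hf : IntegrableOn f D) :
    ∫ x in D, f x = ∑ i, ∫ x in voronoiCell D s i, f x := by
  have h := integral_iUnion_ae (fun i => (measurableSet_voronoiCell (s := s) hD i).nullMeasurableSet)
    (aedisjoint_voronoiCell hs) (by rwa [iUnion_voronoiCell hn])
  rwa [iUnion_voronoiCell hn, tsum_fintype] at h

/-- If the cells have comparable volumes, an average over the sites of values dominated by `f` on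
the corresponding cells is controlled by the average of `f` over `D`. -/
theorem volume_mul_average_le (hD : MeasurableSet D) (hDfin : volume D ≠ ⊤) (hn : 0 < n)
    (hs : Function.Injective s) {γ : ℝ} (hcell : ∀ i, 0 < volume.real (voronoiCell D s i))
    (hγ : ∀ i j, volume.real (voronoiCell D s i) / volume.real (voronoiCell D s j) ≤ γ)
    {f : EuclideanSpace ℝ (Fin d) → ℝ} (hf : IntegrableOn f D) {t : Fin n → ℝ}
    (ht0 : ∀ i, 0 ≤ t i) (ht : ∀ i, ∀ x ∈ voronoiCell D s i, t i ≤ f x) :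
    volume.real D * ((1 / (n : ℝ)) * ∑ i, t i) ≤ γ * ∫ x in D, f x := by
  have hn' : (0 : ℝ) < n := by exact_mod_cast hn
  have hγ0 : 0 ≤ γ := (div_pos (hcell ⟨0, hn⟩) (hcell ⟨0, hn⟩)).le.trans (hγ _ _)
  have hvol : volume.real D = ∑ j, volume.real (voronoiCell D s j) := by
    have := setIntegral_eq_sum_voronoiCell hD hn hs (f := fun _ => (1 : ℝ))
      (integrableOn_const hDfin)
    simpa using this
  have hle : ∀ i, volume.real D ≤ n * (γ * volume.real (voronoiCell D s i)) := fun i => by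
    rw [hvol]
    calc ∑ j, volume.real (voronoiCell D s j)
        ≤ ∑ _j : Fin n, γ * volume.real (voronoiCell D s i) :=
          Finset.sum_le_sum fun j _ => (div_le_iff₀ (hcell i)).1 (hγ j i)
      _ = n * (γ * volume.real (voronoiCell D s i)) := by simp
  have hint : ∀ i, volume.real (voronoiCell D s i) * t i ≤ ∫ x in voronoiCell D s i, f x :=
    fun i => by
    have hfin : volume (voronoiCell D s i) ≠ ⊤ :=
      measure_ne_top_of_subset (voronoiCell_subset i) hDfin
    have h : ∫ _ in voronoiCell D s i, t i ≤ ∫ x in voronoiCell D s i, f x :=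
      setIntegral_mono_on (integrableOn_const hfin) (hf.mono_set (voronoiCell_subset i))
        (measurableSet_voronoiCell hD i) (ht i)
    simpa using h
  rw [setIntegral_eq_sum_voronoiCell hD hn hs hf, Finset.mul_sum, Finset.mul_sum, Finset.mul_sum]
  refine Finset.sum_le_sum fun i _ => ?_
  calc volume.real D * (1 / (n : ℝ) * t i)
      ≤ n * (γ * volume.real (voronoiCell D s i)) * (1 / (n : ℝ) * t i) :=
        mul_le_mul_of_nonneg_right (hle i) (mul_nonneg (by positivity) (ht0 i))
    _ = γ * (volume.real (voronoiCell D s i) * t i) := by field_simp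
    _ ≤ γ * ∫ x in voronoiCell D s i, f x := mul_le_mul_of_nonneg_left (hint i) hγ0

theorem dist_site_le_maxCellDiam (hD : Bornology.IsBounded D) (hsD : ∀ i, s i ∈ D) {i : Fin n}
    {x : EuclideanSpace ℝ (Fin d)} (hx : x ∈ voronoiCell D s i) :
    dist x (s i) ≤ maxCellDiam D s := by
  have hsi : s i ∈ voronoiCell D s i := ⟨hsD i, fun j => by simp⟩
  exact (Metric.dist_le_diam_of_mem (hD.subset (voronoiCell_subset i)) hx hsi).trans
    (le_ciSup (Set.finite_range fun i => Metric.diam (voronoiCell D s i)).bddAbove i)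

theorem maxCellDiam_nonneg : 0 ≤ maxCellDiam D s :=
  Real.iSup_nonneg fun _ => Metric.diam_nonneg

end VoronoiCells

section LocalCoefficient

variable {E : Type*} [PseudoMetricSpace E] {D : Set E} {K : E → E → ℝ}

theorem localCoeff_le {δ : ℝ} {x₁ x₂ : E} (h₁ : x₁ ∈ D) (h₂ : x₂ ∈ D) (h : dist x₁ x₂ ≤ δ) :
    localCoeff D K δ ≤ (K x₁ x₂ / K x₂ x₂) ^ 2 :=
  csInf_le ⟨0, by rintro _ ⟨_, _, _, _, _, rfl⟩; positivity⟩ ⟨x₁, h₁, x₂, h₂, h, rfl⟩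

theorem localCoeff_le_one {δ : ℝ} (hδ : 0 ≤ δ) {x : E} (hx : x ∈ D) (hK : K x x ≠ 0) :
    localCoeff D K δ ≤ 1 := by
  simpa [div_self hK] using localCoeff_le (K := K) hx hx (by simpa using hδ)

/-- By uniform continuity, nearby points `x₁, x₂` have `K x₁ x₂` at least half of `K x₂ x₂`, which
is bounded below. -/
theorem exists_forall_localCoeff_pos (hD : IsCompact D) (hne : D.Nonempty)
    (hK : ContinuousOn (Function.uncurry K) (D ×ˢ D)) (hpos : ∀ x ∈ D, 0 < K x x) :
    ∃ δ₀ > 0, ∀ δ, 0 ≤ δ → δ < δ₀ → 0 < localCoeff D K δ := by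
  have hdiag : ContinuousOn (fun x => K x x) D :=
    hK.comp (f := fun x => (x, x)) (by fun_prop) fun x hx => ⟨hx, hx⟩
  obtain ⟨x₀, hx₀, hmin⟩ := hD.exists_isMinOn hne hdiag
  obtain ⟨δ₀, hδ₀, hδ⟩ := Metric.uniformContinuousOn_iff.1
    ((hD.prod hD).uniformContinuousOn_of_continuous hK) (K x₀ x₀ / 2) (half_pos (hpos x₀ hx₀))
  refine ⟨δ₀, hδ₀, fun δ hδ0 hδlt => lt_of_lt_of_le (b := 1 / 4) (by norm_num) ?_⟩
  refine le_csInf ⟨_, x₀, hx₀, x₀, hx₀, by simpa using hδ0, rfl⟩ ?_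
  rintro _ ⟨x₁, h₁, x₂, h₂, hd, rfl⟩
  have h := hδ (x₁, x₂) ⟨h₁, h₂⟩ (x₂, x₂) ⟨h₂, h₂⟩ (by
    rw [Prod.dist_eq]; simpa [hδ₀] using hd.trans_lt hδlt)
  rw [Real.dist_eq] at h
  have hle : K x₀ x₀ ≤ K x₂ x₂ := hmin h₂
  have h' : K x₂ x₂ - K x₀ x₀ / 2 < K x₁ x₂ := by
    have := (abs_lt.1 h).1
    simp only [Function.uncurry_apply_pair] at this
    linarith
  have hhalf : 1 / 2 ≤ K x₁ x₂ / K x₂ x₂ := by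
    rw [le_div_iff₀ (hpos x₂ h₂)]
    linarith
  calc (1 / 4 : ℝ) = (1 / 2) ^ 2 := by norm_num
    _ ≤ (K x₁ x₂ / K x₂ x₂) ^ 2 := by gcongr

end LocalCoefficient

/-! ### Comparison of the kernel matrix with the integral operator -/

section Assembly

theorem integral_norm_sq_starProjection_orthogonal {α H : Type*} [MeasurableSpace α]
    {ν : Measure α} [NormedAddCommGroup H] [InnerProductSpace ℝ H] {y : α → H} (hy : MemLp y 2 ν)
    {m : ℕ} {e : Fin m → H} (he : Orthonormal ℝ e) (S : Submodule ℝ H) [FiniteDimensional ℝ S]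
    (hS : Submodule.span ℝ (Set.range e) = S) :
    ∫ x, ‖Sᗮ.starProjection (y x)‖ ^ 2 ∂ν =
      ∫ x, ‖y x‖ ^ 2 ∂ν - ∑ l, ‖analysisOperator hy (e l)‖ ^ 2 := by
  simp only [norm_sq_starProjection_orthogonal_span he S hS, norm_sq_analysisOperator]
  rw [integral_sub (hy.integrable_norm_pow (by norm_num))
    (integrable_finsetSum _ fun l _ => integrable_inner_sq hy (e l)),
    integral_finsetSum _ fun l _ => integrable_inner_sq hy (e l)]

variable {d : ℕ} {D : Set (EuclideanSpace ℝ (Fin d))}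

theorem memLp_two_of_continuousOn {H : Type*} [NormedAddCommGroup H] (hD : IsCompact D) {y : EuclideanSpace ℝ (Fin d) → H}
    (hy : ContinuousOn y D) : MemLp y 2 (volume.restrict D) := by
  have : IsFiniteMeasure (volume.restrict D) := ⟨by simpa using hD.measure_lt_top⟩
  obtain ⟨R, hR⟩ := hD.exists_bound_of_continuousOn hy
  exact MemLp.of_bound (hy.aestronglyMeasurable hD.measurableSet) R
    ((ae_restrict_mem hD.measurableSet).mono hR)

theorem isCompactOperator_analysisOperator_of_continuousOn {H : Type*} [NormedAddCommGroup H]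
    [InnerProductSpace ℝ H] (hD : IsCompact D) {y : EuclideanSpace ℝ (Fin d) → H} (hy : ContinuousOn y D)
    (hmem : MemLp y 2 (volume.restrict D)) : IsCompactOperator (analysisOperator hmem) := by
  have : IsFiniteMeasure (volume.restrict D) := ⟨by simpa using hD.measure_lt_top⟩
  refine isCompactOperator_analysisOperator hmem fun ε hε => ?_
  obtain ⟨V, hfin, hV⟩ := exists_starProjection_near_of_isCompact (hD.image_of_continuousOn hy) hε
  exact ⟨V, hfin, (ae_restrict_mem hD.measurableSet).mono fun x hx =>
    hV _ (Set.mem_image_of_mem y hx)⟩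

variable {H : Type*} [NormedAddCommGroup H] [InnerProductSpace ℝ H] [CompleteSpace H]

/-- The trace `∫_D ‖y x‖²` exceeds the sum of the first `n` eigenvalues by at most the integrated
squared distance of `y x` from the span of `n` vectors. -/
theorem integral_norm_sq_le (hD : IsCompact D) {y : EuclideanSpace ℝ (Fin d) → H}
    (hy : ContinuousOn y D) {K : EuclideanSpace ℝ (Fin d) → EuclideanSpace ℝ (Fin d) → ℝ}
    (hK : ∀ s ∈ D, ∀ x ∈ D, K s x = inner ℝ (y s) (y x)) (n : ℕ) (S : Submodule ℝ H)
    [FiniteDimensional ℝ S] (hS : Module.finrank ℝ S ≤ n) {ε : ℝ} (hε : 0 < ε) :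
    ∫ x in D, ‖y x‖ ^ 2 ≤ ∑ j ∈ Finset.range n, (klEigenvalue D K j + ε) +
      ∫ x in D, ‖Sᗮ.starProjection (y x)‖ ^ 2 := by
  have hmem := memLp_two_of_continuousOn hD hy
  obtain ⟨e, he, heS, hsum⟩ := exists_orthonormal_sum_le (fun g => ‖analysisOperator hmem g‖ ^ 2)
    (fun j => klEigenvalue D K j + ε) n
    (fun j _ => by
      rw [klEigenvalue_eq_countedEigenvalue hD.measurableSet hmem hK]
      exact add_nonneg (countedEigenvalue_nonneg _ _) hε.le)
    (fun j _ => by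
      rw [klEigenvalue_eq_countedEigenvalue hD.measurableSet hmem hK]
      exact exists_finrank_le_norm_sq_le _
        (isCompactOperator_analysisOperator_of_continuousOn hD hy hmem) j hε) S hS
  rw [integral_norm_sq_starProjection_orthogonal hmem he S heS]
  linarith

/-- Some space of dimension at most `k`, close to the span of the first `k` Karhunen–Loève
modes, captures the first `k` eigenvalues up to `ε` each. -/
theorem exists_integral_norm_sq_starProjection_le (hD : IsCompact D)
    {y : EuclideanSpace ℝ (Fin d) → H} (hy : ContinuousOn y D)
    {K : EuclideanSpace ℝ (Fin d) → EuclideanSpace ℝ (Fin d) → ℝ}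
    (hK : ∀ s ∈ D, ∀ x ∈ D, K s x = inner ℝ (y s) (y x)) (k : ℕ) {ε : ℝ} (hε : 0 < ε) :
    ∃ L : Submodule ℝ H, ∃ _ : FiniteDimensional ℝ L, Module.finrank ℝ L ≤ k ∧
      ∫ x in D, ‖Lᗮ.starProjection (y x)‖ ^ 2 ≤
        (∫ x in D, ‖y x‖ ^ 2) - ∑ j ∈ Finset.range k, (klEigenvalue D K j - ε) := by
  have hmem := memLp_two_of_continuousOn hD hy
  obtain ⟨m, hm, e, he, hsum⟩ := exists_orthonormal_le_sum
    (fun g => ‖analysisOperator hmem g‖ ^ 2) (fun j => klEigenvalue D K j - ε) (fun j => by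
      simp only [klEigenvalue_eq_countedEigenvalue hD.measurableSet hmem hK]
      exact exists_le_rank_le_norm_sq _ j hε) k
  have hfin := FiniteDimensional.span_of_finite ℝ (Set.finite_range e)
  refine ⟨Submodule.span ℝ (Set.range e), hfin, ?_, ?_⟩
  · rwa [finrank_span_eq_card he.linearIndependent, Fintype.card_fin]
  · rw [integral_norm_sq_starProjection_orthogonal hmem he _ rfl]
    linarith

/-- The bound for a fixed set of sites, with explicit constants. The variables `y x` are vectors
of a Hilbert space with Gram kernel `K`. -/
theorem average_kernelMatrixEigenvalue_tail_le (hD : IsCompact D)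
    {Ω : Type*} [MeasurableSpace Ω] (P : Measure Ω) (Y : EuclideanSpace ℝ (Fin d) → Ω → ℝ)
    {y : EuclideanSpace ℝ (Fin d) → H} (hy : ContinuousOn y D)
    (hK : ∀ s ∈ D, ∀ x ∈ D, covKernel P Y s x = inner ℝ (y s) (y x)) {m M γ : ℝ} (hm : 0 < m)
    (hmy : ∀ x ∈ D, m ≤ ‖y x‖ ^ 2) (hMy : ∀ x ∈ D, ‖y x‖ ^ 2 ≤ M) {n : ℕ} (hn : 0 < n)
    {s : Fin n → EuclideanSpace ℝ (Fin d)} (hsD : ∀ i, s i ∈ D) (hs : Function.Injective s)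
    (hcell : ∀ i, 0 < volume.real (voronoiCell D s i))
    (hγ : ∀ i j, volume.real (voronoiCell D s i) / volume.real (voronoiCell D s j) ≤ γ)
    (hc0 : 0 < localCoeff D (covKernel P Y) (maxCellDiam D s)) {k : ℕ} (hk : k ≤ n) :
    (1 / (n : ℝ)) * ∑ i ∈ Finset.univ.filter (fun i : Fin n => k ≤ (i : ℕ)),
        kernelMatrixEigenvalue P Y s i ≤
      2 * γ * (M / m) / volume.real D * ∑ i ∈ Finset.Ico k n, klEigenvalue D (covKernel P Y) i +
        2 * γ * M * (M / m + 1) *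
          (1 / localCoeff D (covKernel P Y) (maxCellDiam D s) - 1) := by
  set K := covKernel P Y
  set c := localCoeff D K (maxCellDiam D s)
  have hKself : ∀ x ∈ D, K x x = ‖y x‖ ^ 2 := fun x hx => by
    rw [hK x hx x hx, real_inner_self_eq_norm_sq]
  have hy0 : ∀ x ∈ D, y x ≠ 0 := fun x hx h => by
    have := hmy x hx
    rw [h, norm_zero, zero_pow two_ne_zero] at this
    linarith
  have hc1 : c ≤ 1 := localCoeff_le_one maxCellDiam_nonneg (hsD ⟨0, hn⟩) (by
    rw [hKself _ (hsD _)]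
    exact pow_ne_zero 2 (norm_ne_zero_iff.2 (hy0 _ (hsD _))))
  have hDfin : volume D ≠ ⊤ := hD.measure_lt_top.ne
  have hDpos : 0 < volume.real D :=
    (hcell ⟨0, hn⟩).trans_le (measureReal_mono (voronoiCell_subset _) hDfin)
  have hM : 0 ≤ M := (sq_nonneg _).trans (hMy _ (hsD ⟨0, hn⟩))
  have hγ0 : 0 ≤ γ := (div_pos (hcell ⟨0, hn⟩) (hcell ⟨0, hn⟩)).le.trans (hγ _ _)
  -- within a cell, the variable at the site and the one at the point are strongly correlated
  have hcorr : ∀ i, ∀ x ∈ voronoiCell D s i,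
      c * (‖y x‖ ^ 2 * ‖y (s i)‖ ^ 2) ≤ inner ℝ (y x) (y (s i)) ^ 2 := fun i x hx => by
    have hxD := voronoiCell_subset i hx
    have hdist := dist_site_le_maxCellDiam hD.isBounded hsD hx
    refine mul_le_inner_sq (hy0 x hxD) (hy0 _ (hsD i)) hc0.le ?_ ?_
    · have := localCoeff_le (K := K) hxD (hsD i) hdist
      rwa [hK x hxD _ (hsD i), hKself _ (hsD i)] at this
    · have := localCoeff_le (K := K) (hsD i) hxD (dist_comm x (s i) ▸ hdist)
      rwa [hK _ (hsD i) x hxD, hKself _ hxD, real_inner_comm] at this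
  have hint : ∀ U : Submodule ℝ H, ∀ _ : U.HasOrthogonalProjection,
      IntegrableOn (fun x => ‖U.starProjection (y x)‖ ^ 2) D := fun U _ =>
    ((U.starProjection.continuous.comp_continuousOn hy).norm.pow 2).integrableOn_compact hD
  -- the values at the sites span a space close to all the `y x`
  let S : Submodule ℝ H := Submodule.span ℝ (Set.range (y ∘ s))
  have hSfin : FiniteDimensional ℝ S := FiniteDimensional.span_of_finite ℝ (Set.finite_range _)
  have hSdim : Module.finrank ℝ S ≤ n :=
    (finrank_range_le_card (R := ℝ) (y ∘ s)).trans_eq (Fintype.card_fin n)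
  have hSint : ∫ x in D, ‖Sᗮ.starProjection (y x)‖ ^ 2 ≤ volume.real D * (M * (1 / c - 1)) := by
    have h : ∫ x in D, ‖Sᗮ.starProjection (y x)‖ ^ 2 ≤ ∫ _ in D, M * (1 / c - 1) := by
      refine setIntegral_mono_on (hint _ inferInstance) (integrableOn_const hDfin)
        hD.measurableSet fun x hx => ?_
      obtain ⟨i, hi⟩ := Set.mem_iUnion.1 ((iUnion_voronoiCell (D := D) (s := s) hn).symm ▸ hx)
      exact norm_sq_starProjection_orthogonal_le_of_mem S (Submodule.subset_span ⟨i, rfl⟩)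
        (hMy x hx) (hy0 _ (hsD i)) hc0 hc1 (hcorr i x hi)
    simpa using h
  set Λ := ∑ i ∈ Finset.Ico k n, klEigenvalue D K i
  set t := ∑ i ∈ Finset.univ.filter (fun i : Fin n => k ≤ (i : ℕ)),
    kernelMatrixEigenvalue P Y s i
  have hstep : ∀ ε : ℝ, 0 < ε → volume.real D * ((1 / (n : ℝ)) * t) ≤
      γ * (2 * (M / m) * (Λ + 2 * n * ε + volume.real D * (M * (1 / c - 1))) +
        volume.real D * (2 * M * (1 / c - 1))) := fun ε hε => by
    obtain ⟨L, hLfin, hLdim, hL⟩ := exists_integral_norm_sq_starProjection_le hD hy hK k hε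
    have htr := integral_norm_sq_le hD hy hK n S hSdim hε
    have htail : t ≤ ∑ i, ‖Lᗮ.starProjection (y (s i))‖ ^ 2 :=
      sum_kernelMatrixEigenvalue_tail_le P Y s (fun i => y (s i))
        (fun i j => hK _ (hsD i) _ (hsD j)) hk L hLdim
    have hW : ∫ x in D, ‖Lᗮ.starProjection (y x)‖ ^ 2 ≤
        Λ + 2 * n * ε + volume.real D * (M * (1 / c - 1)) := by
      have hsplit := Finset.sum_range_add_sum_Ico (klEigenvalue D K) hk
      have hkn : (k : ℝ) * ε ≤ n * ε := by gcongr
      simp only [Finset.sum_add_distrib, Finset.sum_sub_distrib, Finset.sum_const,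
        Finset.card_range, nsmul_eq_mul] at htr hL
      linarith
    have hconst : IntegrableOn (fun _ => 2 * M * (1 / c - 1)) D := integrableOn_const hDfin
    have hmul := (hint Lᗮ inferInstance).const_mul (2 * (M / m))
    have havg := volume_mul_average_le hD.measurableSet hDfin hn hs hcell hγ
      (f := fun x => 2 * (M / m) * ‖Lᗮ.starProjection (y x)‖ ^ 2 + 2 * M * (1 / c - 1))
      (Integrable.fun_add hmul hconst)
      (t := fun i => ‖Lᗮ.starProjection (y (s i))‖ ^ 2) (fun i => sq_nonneg _)
      (fun i x hx => by
        have hxD := voronoiCell_subset i hx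
        refine norm_sq_starProjection_le_two_mul Lᗮ hm (hMy _ (hsD i)) (hmy x hxD) hc0 hc1 ?_
        rw [mul_comm (‖y (s i)‖ ^ 2), real_inner_comm]
        exact hcorr i x hx)
    rw [integral_add hmul hconst,
      integral_const_mul] at havg
    simp only [integral_const, measureReal_restrict_apply_univ, smul_eq_mul] at havg
    refine le_trans ?_ (havg.trans ?_)
    · gcongr
    · gcongr
  -- let `ε` tend to `0`
  have hlim : volume.real D * ((1 / (n : ℝ)) * t) ≤
      γ * (2 * (M / m) * (Λ + 2 * n * 0 + volume.real D * (M * (1 / c - 1))) +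
        volume.real D * (2 * M * (1 / c - 1))) := by
    have hcont : Continuous fun ε : ℝ =>
        γ * (2 * (M / m) * (Λ + 2 * n * ε + volume.real D * (M * (1 / c - 1))) +
          volume.real D * (2 * M * (1 / c - 1))) := by fun_prop
    exact ge_of_tendsto ((hcont.tendsto 0).mono_left nhdsWithin_le_nhds)
      (eventually_mem_nhdsWithin.mono hstep : ∀ᶠ ε in 𝓝[>] (0 : ℝ), _)
  refine le_of_mul_le_mul_left (hlim.trans_eq ?_) hDpos
  field_simp
  ring

/-- The variables of a second-order process, as vectors of `L²(P)`, form a continuous curve when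
the covariance function is continuous. -/
theorem exists_continuousOn_inner_eq_covKernel {E Ω : Type*} [TopologicalSpace E]
    [MeasurableSpace Ω] (P : Measure Ω) [IsProbabilityMeasure P] {D : Set E} {Y : E → Ω → ℝ}
    (hY : ∀ s ∈ D, MemLp (Y s) 2 P) (hmean : ∀ s ∈ D, ∫ ω, Y s ω ∂P = 0)
    (hK : ContinuousOn (Function.uncurry (covKernel P Y)) (D ×ˢ D)) :
    ∃ y : E → Lp ℝ 2 P, ContinuousOn y D ∧
      ∀ s ∈ D, ∀ x ∈ D, covKernel P Y s x = inner ℝ (y s) (y x) := by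
  classical
  let y : E → Lp ℝ 2 P := fun s => if h : s ∈ D then (hY s h).toLp (Y s) else 0
  have hinner : ∀ s ∈ D, ∀ x ∈ D, covKernel P Y s x = inner ℝ (y s) (y x) := by
    intro s hs x hx
    simp only [y, hs, hx, dif_pos, L2.inner_def, covKernel, covariance, hmean s hs, hmean x hx,
      sub_zero]
    refine integral_congr_ae ?_
    filter_upwards [(hY s hs).coeFn_toLp, (hY x hx).coeFn_toLp] with ω h1 h2
    rw [h1, h2]
    simp [mul_comm]
  refine ⟨y, fun x hx => ?_, hinner⟩
  rw [ContinuousWithinAt, tendsto_iff_norm_sub_tendsto_zero]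
  have hsq : Tendsto (fun s => ‖y s - y x‖ ^ 2) (𝓝[D] x) (𝓝 0) := by
    have h1 : Tendsto (fun s => covKernel P Y s s) (𝓝[D] x) (𝓝 (covKernel P Y x x)) :=
      hK.comp (f := fun s => (s, s)) (by fun_prop) (fun s hs => ⟨hs, hs⟩) x hx
    have h2 : Tendsto (fun s => covKernel P Y s x) (𝓝[D] x) (𝓝 (covKernel P Y x x)) :=
      hK.comp (f := fun s => (s, x)) (by fun_prop) (fun s hs => ⟨hs, hx⟩) x hx
    have h3 := (h1.sub (h2.const_mul 2)).add_const (covKernel P Y x x)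
    have h0 : covKernel P Y x x - 2 * covKernel P Y x x + covKernel P Y x x = 0 := by ring
    rw [h0] at h3
    refine h3.congr' (eventually_mem_nhdsWithin.mono fun s hs => ?_)
    change _ = ‖y s - y x‖ ^ 2
    rw [norm_sub_sq_real, ← hinner s hs x hx, ← real_inner_self_eq_norm_sq,
      ← real_inner_self_eq_norm_sq, ← hinner s hs s hs, ← hinner x hx x hx]
  have := hsq.sqrt
  simpa [Real.sqrt_sq] using this

end Assembly

theorem theorem1 {d : ℕ} (D : Set (EuclideanSpace ℝ (Fin d))) (hD : IsCompact D)
    {Ω : Type*} [MeasurableSpace Ω] (P : Measure Ω) [IsProbabilityMeasure P]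
    (Y : EuclideanSpace ℝ (Fin d) → Ω → ℝ)
    (hY : ∀ s ∈ D, MemLp (Y s) 2 P) (hmean : ∀ s ∈ D, ∫ ω, Y s ω ∂P = 0)
    (hK : ContinuousOn (Function.uncurry (covKernel P Y)) (D ×ˢ D))
    (hpos : ∀ x ∈ D, 0 < covKernel P Y x x) (γ : ℝ) :
    ∃ C₁ C₂ : ℝ, 0 < C₁ ∧ 0 < C₂ ∧
      ∀ s : (n : ℕ) → Fin n → EuclideanSpace ℝ (Fin d),
        (∀ n i, s n i ∈ D) →
        (∀ n, Function.Injective (s n)) →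
        Tendsto (fun n => maxCellDiam D (s n)) atTop (𝓝 0) →
        (∀ n i, 0 < volume.real (voronoiCell D (s n) i)) →
        (∀ n i j, volume.real (voronoiCell D (s n) i) / volume.real (voronoiCell D (s n) j) ≤ γ) →
        (∀ᶠ n in atTop, 0 < localCoeff D (covKernel P Y) (maxCellDiam D (s n))) ∧
        ∀ n, 1 ≤ n → 0 < localCoeff D (covKernel P Y) (maxCellDiam D (s n)) →
          ∀ k ≤ n,
            (1 / (n : ℝ)) * ∑ i ∈ Finset.univ.filter (fun i : Fin n => k ≤ (i : ℕ)),
                kernelMatrixEigenvalue P Y (s n) i ≤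
              C₁ * ∑ i ∈ Finset.Ico k n, klEigenvalue D (covKernel P Y) i +
                C₂ * (1 / localCoeff D (covKernel P Y) (maxCellDiam D (s n)) - 1) := by
  -- a compact set of measure zero carries no cells of positive volume, so any constants do
  by_cases hvol : volume.real D = 0
  · refine ⟨1, 1, one_pos, one_pos, fun s _ _ _ hcell _ => absurd (hcell 1 0) (not_lt.2 ?_)⟩
    exact (measureReal_mono (voronoiCell_subset _) hD.measure_lt_top.ne).trans hvol.le
  have hvol' : 0 < volume.real D := lt_of_le_of_ne measureReal_nonneg (Ne.symm hvol)
  have hne : D.Nonempty := by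
    by_contra h
    rw [Set.not_nonempty_iff_eq_empty.1 h] at hvol
    simp at hvol
  obtain ⟨y, hy, hKy⟩ := exists_continuousOn_inner_eq_covKernel P hY hmean hK
  have hKself : ∀ x ∈ D, ‖y x‖ ^ 2 = covKernel P Y x x := fun x hx => by
    rw [hKy x hx x hx, real_inner_self_eq_norm_sq]
  obtain ⟨x₀, hx₀, hmin⟩ := hD.exists_isMinOn hne (hy.norm.pow 2)
  obtain ⟨x₁, hx₁, hmax⟩ := hD.exists_isMaxOn hne (hy.norm.pow 2)
  have hm : 0 < ‖y x₀‖ ^ 2 := (hpos x₀ hx₀).trans_eq (hKself x₀ hx₀).symm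
  have hM : 0 < ‖y x₁‖ ^ 2 := (hpos x₁ hx₁).trans_eq (hKself x₁ hx₁).symm
  have hγ : 0 < max γ 1 := lt_max_of_lt_right one_pos
  refine ⟨2 * max γ 1 * (‖y x₁‖ ^ 2 / ‖y x₀‖ ^ 2) / volume.real D,
    2 * max γ 1 * ‖y x₁‖ ^ 2 * (‖y x₁‖ ^ 2 / ‖y x₀‖ ^ 2 + 1), by positivity, by positivity, ?_⟩
  intro s hsD hs hδ hcell hratio
  constructor
  · obtain ⟨δ₀, hδ₀, hpos'⟩ := exists_forall_localCoeff_pos hD hne hK hpos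
    filter_upwards [hδ.eventually_lt_const hδ₀] with n hn
    exact hpos' _ maxCellDiam_nonneg hn
  · intro n hn hc k hk
    exact average_kernelMatrixEigenvalue_tail_le hD P Y hy hKy hm (fun x hx => hmin hx)
      (fun x hx => hmax hx) hn (hsD n) (hs n) (hcell n)
      (fun i j => (hratio n i j).trans (le_max_left _ _)) hc hk
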